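/- **Circuits.** A quantum circuit $C$ is an acyclic oriented bipartite graph with s-nodes and o-nodes. Each s-node $s$ has a dimension $d(s)\in\mathbb N$, at most one incoming and at most one outgoing arrow. Each o-node has an ordered (finite) list $\Gamma$ of incoming s-nodes and an ordered (finite) list $\Gamma'$ of outgoing s-nodes, and carries either a unitary operator $U:\mathbb C^{d(\Gamma)}\to\mathbb C^{d(\Gamma')}$ (written $\Gamma'=U(\Gamma)$) or, when $d(\Gamma)=d(\Gamma')$, the orthogonal projection onto a subspace $q$ of $\mathbb C^{d(\Gamma)}$ (written $\Gamma'=\mathrm{Mes}_q(\Gamma)$); here $d([s_1,\dots,s_n])=\prod_i d(s_i)$. A slice of $C$ is a finite list, without repetition, of s-nodes no two of which are joined by a directed path; $\Gamma::\Delta$ denotes concatenation. Let $L_n$ be the lattice of subspaces of $\mathbb C^n$, with $p\mathbin{\&}q=q\wedge(p\vee q^\perp)$, and identify $\mathbb C^{d(\Gamma::\Delta)}$ with $\mathbb C^{d(\Gamma)}\otimes\mathbb C^{d(\Delta)}$. An s-node $n$ is in the strong past of a slice $\Delta'$ if every maximal directed path starting at $n$ meets $\Delta'$ (possibly at $n$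 itself); a slice $\Delta$ is in the strong past of $\Delta'$ if all its s-nodes are. **Verification statements.** For a slice $\Gamma$ and $p\in L_{d(\Gamma)}$, the statement $\Gamma\Vdash p$ (in $C$) means that it is derivable by the following rules, all lists being slices of $C$: - (Top) $\Gamma\Vdash\top$; - (Ord) from $\Gamma\Vdash p$ and $p\le q$, infer $\Gamma\Vdash q$; - (Meet) from $\Gamma\Vdash p$ and $\Gamma\Vdash q$, infer $\Gamma\Vdash p\wedge q$; - (Swap) from $\Gamma::\Delta::\Xi\Vdash p$, infer $\Delta::\Gamma::\Xi\Vdash p'$, where $p'$ is the image of $p$ under the unitary operator $x\otimes y\otimes z\mapsto y\otimes x\otimes z$; - (Sas) from $\Gamma::\Delta\Vdash p$ and an o-node $\Gamma'=\mathrm{Mes}_q(\Gamma)$ of $C$, infer $\Gamma'::\Delta\Vdash p\mathbin{\&}(q\otimes\top)$; - (Uni) from $\Gamma::\Delta\Vdash p$ and an o-node $\Gamma'=U(\Gamma)$ of $C$, infer $\Gamma'::\Delta\Vdash (U\otimes\mathrm{Id})(p)$; - (Tens) from $\Gamma\Vdash p$, infer $\Gamma::\Delta\Vdash p\otimes\top$.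 Write $\Gamma\Vdash p\mathbin{@}\Delta$ for $\Gamma::\Delta\Vdash p\otimes\top_\Delta$, and $k_C(\Gamma\mid\Delta)=\min\{p\in L_{d(\Gamma)}:\Gamma\Vdash p\mathbin{@}\Delta\}$. **Theorem.** Let $\Gamma::\Delta$ and $\Gamma::\Delta'$ be slices of a quantum circuit $C$ such that $\Delta$ is in the strong past of $\Delta'$. Then for all $p\in L_{d(\Gamma)}$, $$\Gamma\Vdash p\mathbin{@}\Delta\ \Longrightarrow\ \Gamma\Vdash p\mathbin{@}\Delta'.$$ Moreover the minima $k_C(\Gamma\mid\Delta)$ and $k_C(\Gamma\mid\Delta')$ exist, and $$k_C(\Gamma\mid\Delta')\le k_C(\Gamma\mid\Delta).$$ -/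

import Mathlib

universe u v

namespace QCircuit

/-- The Hilbert space `ℂⁿ`. -/
abbrev H (n : ℕ) : Type := EuclideanSpace ℂ (Fin n)

/-- The orthomodular lattice `Lₙ` of subspaces of `ℂⁿ`. -/
abbrev L (n : ℕ) : Type := Submodule ℂ (H n)

/-- The unitary `ℂᵐ → ℂⁿ` which relabels the standard basis along `e`. -/
noncomputable def reindex {m n : ℕ} (e : Fin m ≃ Fin n) : H m ≃ₗᵢ[ℂ] H n :=
  LinearIsometryEquiv.piLpCongrLeft 2 ℂ ℂ e

/-- The identification of `L m` with `L n` when `m = n`. -/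
noncomputable def castL {m n : ℕ} (h : m = n) (p : L m) : L n :=
  p.map (reindex (finCongr h)).toLinearMap

/-- The Sasaki operator `p & q = q ∧ (p ∨ qᗮ)`. -/
noncomputable def sasaki {n : ℕ} (p q : L n) : L n := q ⊓ (p ⊔ qᗮ)

/-- The operation carried by an o-node with total input dimension `m` and total output dimension
`n`: a unitary operator `ℂᵐ → ℂⁿ`, or (when `m = n`) an orthogonal projection, given by the
subspace onto which it projects, i.e. the outcome of the measurement. -/
inductive Gate (m n : ℕ) : Type
  | unitary (U : H m ≃ₗᵢ[ℂ] H n) : Gate m n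
  | mes (h : m = n) (q : L m) : Gate m n

/-- The arrows of the bipartite graph on the s-nodes `S` and the o-nodes `O` in which `inp o` and
`out o` list the s-nodes entering and leaving the o-node `o`. -/
inductive Arrow {S : Type u} {O : Type v} (inp out : O → List S) : S ⊕ O → S ⊕ O → Prop
  | enter {s : S} {o : O} : s ∈ inp o → Arrow inp out (Sum.inl s) (Sum.inr o)
  | leave {o : O} {s : S} : s ∈ out o → Arrow inp out (Sum.inr o) (Sum.inl s)

/-- The dimension of an ordered list of s-nodes: the product of the dimensions of its members. -/
def listDim {S : Type u} (dim : S → ℕ) (Γ : List S) : ℕ := (Γ.map dim).prod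

theorem listDim_append {S : Type u} (dim : S → ℕ) (Γ Δ : List S) :
    listDim dim Γ * listDim dim Δ = listDim dim (Γ ++ Δ) := by
  simp [listDim]

/-- A quantum circuit with s-nodes `S` and o-nodes `O`. -/
structure Circuit (S : Type u) (O : Type v) where
  /-- the dimension of an s-node -/
  dim : S → ℕ
  /-- the ordered list of the s-nodes entering an o-node -/
  inp : O → List S
  /-- the ordered list of the s-nodes leaving an o-node -/
  out : O → List S
  /-- the operation carried by an o-node -/
  op : ∀ o : O, Gate (listDim dim (inp o)) (listDim dim (out o))
  /-- every s-node has at most one outgoing arrow -/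
  inp_nodup : ∀ o : O, (inp o).Nodup
  inp_unique : ∀ (s : S) (o o' : O), s ∈ inp o → s ∈ inp o' → o = o'
  /-- every s-node has at most one incoming arrow -/
  out_nodup : ∀ o : O, (out o).Nodup
  out_unique : ∀ (s : S) (o o' : O), s ∈ out o → s ∈ out o' → o = o'
  /-- there is no oriented cycle -/
  acyclic : ∀ x : S ⊕ O, ¬ Relation.TransGen (Arrow inp out) x x

namespace Circuit

variable {S : Type u} {O : Type v}

/-- The arrows of the circuit. -/
def Arr (C : Circuit S O) : S ⊕ O → S ⊕ O → Prop := Arrow C.inp C.out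

/-- `a` is strictly in the past of `b`: there is a nonempty sequence of arrows from `a` to `b`. -/
def Before (C : Circuit S O) (a b : S ⊕ O) : Prop := Relation.TransGen C.Arr a b

/-- A slice: an ordered set (list without repetition) of mutually incomparable s-nodes.
Concatenation `Γ :: Δ` of slices is the concatenation `Γ ++ Δ` of lists. -/
def IsSlice (C : Circuit S O) (Γ : List S) : Prop :=
  Γ.Nodup ∧ ∀ s ∈ Γ, ∀ t ∈ Γ, ¬ C.Before (Sum.inl s) (Sum.inl t)

/-- The dimension `d(Γ)`. -/
def d (C : Circuit S O) (Γ : List S) : ℕ := listDim C.dim Γ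

/-- The identification of pairs of basis indices of `ℂ^d(Γ)` and `ℂ^d(Δ)` with the basis indices of
`ℂ^d(Γ :: Δ)`, in lexicographic order. -/
def idx (C : Circuit S O) (Γ Δ : List S) : Fin (C.d Γ) × Fin (C.d Δ) ≃ Fin (C.d (Γ ++ Δ)) :=
  finProdFinEquiv.trans (finCongr (listDim_append C.dim Γ Δ))

/-- The tensor product `u ⊗ v` of vectors, as a vector of `ℂ^d(Γ :: Δ)`. -/
noncomputable def tmul (C : Circuit S O) (Γ Δ : List S) (x : H (C.d Γ)) (y : H (C.d Δ)) :
    H (C.d (Γ ++ Δ)) :=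
  WithLp.toLp 2 fun k => x ((C.idx Γ Δ).symm k).1 * y ((C.idx Γ Δ).symm k).2

/-- The tensor product `p ⊗ q` of subspaces, as a subspace of `ℂ^d(Γ :: Δ)`. -/
noncomputable def tensor (C : Circuit S O) (Γ Δ : List S) (p : L (C.d Γ)) (q : L (C.d Δ)) :
    L (C.d (Γ ++ Δ)) :=
  Submodule.span ℂ {z | ∃ x ∈ p, ∃ y ∈ q, z = C.tmul Γ Δ x y}

/-- The operator `A ⊗ Id_Δ` from `ℂ^d(Γ :: Δ)` to `ℂ^d(Γ' :: Δ)`: apply `A` to each of the `d(Δ)`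
columns `i ↦ w (i, j)`. -/
noncomputable def tensorId (C : Circuit S O) {Γ Γ' : List S} (Δ : List S)
    (A : H (C.d Γ) →ₗ[ℂ] H (C.d Γ')) : H (C.d (Γ ++ Δ)) →ₗ[ℂ] H (C.d (Γ' ++ Δ)) where
  toFun w := WithLp.toLp 2 fun k =>
    A (WithLp.toLp 2 fun i => w (C.idx Γ Δ (i, ((C.idx Γ' Δ).symm k).2))) ((C.idx Γ' Δ).symm k).1
  map_add' w w' := by
    ext k
    simp only [PiLp.add_apply]
    rw [← PiLp.add_apply, ← map_add]
    rfl
  map_smul' c w := by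
    ext k
    simp only [PiLp.smul_apply, RingHom.id_apply]
    rw [← PiLp.smul_apply, ← map_smul]
    rfl

/-- The correspondence `(i, j, k) ↦ (j, i, k)` of basis indices. -/
def swapIdx (C : Circuit S O) (Γ Δ Ξ : List S) :
    Fin (C.d (Γ ++ (Δ ++ Ξ))) ≃ Fin (C.d (Δ ++ (Γ ++ Ξ))) where
  toFun a :=
    let i := ((C.idx Γ (Δ ++ Ξ)).symm a).1
    let b := (C.idx Δ Ξ).symm ((C.idx Γ (Δ ++ Ξ)).symm a).2
    C.idx Δ (Γ ++ Ξ) (b.1, C.idx Γ Ξ (i, b.2))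
  invFun a :=
    let i := ((C.idx Δ (Γ ++ Ξ)).symm a).1
    let b := (C.idx Γ Ξ).symm ((C.idx Δ (Γ ++ Ξ)).symm a).2
    C.idx Γ (Δ ++ Ξ) (b.1, C.idx Δ Ξ (i, b.2))
  left_inv a := by simp
  right_inv a := by simp

/-- The image of a subspace under the block swap `e_i ⊗ f_j ⊗ g_k ↦ f_j ⊗ e_i ⊗ g_k`. -/
noncomputable def swap (C : Circuit S O) (Γ Δ Ξ : List S) (p : L (C.d (Γ ++ (Δ ++ Ξ)))) :
    L (C.d (Δ ++ (Γ ++ Ξ))) :=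
  p.map (reindex (C.swapIdx Γ Δ Ξ)).toLinearMap

theorem d_append_congr (C : Circuit S O) {Γ Γ' : List S}
    (h : listDim C.dim Γ = listDim C.dim Γ') (Δ : List S) : C.d (Γ ++ Δ) = C.d (Γ' ++ Δ) := by
  unfold d
  rw [← listDim_append, ← listDim_append, h]

/-- `C.Verifies Γ p` : the verification statement "`Γ` verifies `p`" is derivable in the
circuit `C`. -/
inductive Verifies (C : Circuit S O) : (Γ : List S) → L (C.d Γ) → Prop
  | top {Γ : List S} (hΓ : C.IsSlice Γ) : Verifies C Γ ⊤
  | ord {Γ : List S} {p q : L (C.d Γ)} (hp : Verifies C Γ p) (hpq : p ≤ q) : Verifies C Γ q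
  | meet {Γ : List S} {p q : L (C.d Γ)} (hp : Verifies C Γ p) (hq : Verifies C Γ q) :
      Verifies C Γ (p ⊓ q)
  | swap {Γ Δ Ξ : List S} {p : L (C.d (Γ ++ (Δ ++ Ξ)))} (hp : Verifies C (Γ ++ (Δ ++ Ξ)) p) :
      Verifies C (Δ ++ (Γ ++ Ξ)) (C.swap Γ Δ Ξ p)
  | sas {o : O} {Δ : List S} {p : L (C.d (C.inp o ++ Δ))}
      {h : listDim C.dim (C.inp o) = listDim C.dim (C.out o)} {q : L (C.d (C.inp o))}
      (hp : Verifies C (C.inp o ++ Δ) p) (ho : C.op o = Gate.mes h q)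
      (hs : C.IsSlice (C.out o ++ Δ)) :
      Verifies C (C.out o ++ Δ)
        (castL (C.d_append_congr h Δ) (sasaki p (C.tensor (C.inp o) Δ q ⊤)))
  | uni {o : O} {Δ : List S} {p : L (C.d (C.inp o ++ Δ))}
      {U : H (C.d (C.inp o)) ≃ₗᵢ[ℂ] H (C.d (C.out o))}
      (hp : Verifies C (C.inp o ++ Δ) p) (ho : C.op o = Gate.unitary U)
      (hs : C.IsSlice (C.out o ++ Δ)) :
      Verifies C (C.out o ++ Δ) (p.map (C.tensorId Δ U.toLinearMap))
  | tens {Γ Δ : List S} {p : L (C.d Γ)} (hp : Verifies C Γ p) (hs : C.IsSlice (Γ ++ Δ)) :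
      Verifies C (Γ ++ Δ) (C.tensor Γ Δ p ⊤)

/-- "`Γ` verifies `p` at `Δ`", i.e. `Γ :: Δ` verifies `p ⊗ ⊤`. -/
def VerifiesAt (C : Circuit S O) (Γ : List S) (p : L (C.d Γ)) (Δ : List S) : Prop :=
  C.Verifies (Γ ++ Δ) (C.tensor Γ Δ p ⊤)

/-- The knowledge `k_C(Γ | Δ)`: the least `p` such that `Γ` verifies `p` at `Δ`. It is written as
an infimum; whether the infimum is attained is a separate claim. -/
noncomputable def knowledge (C : Circuit S O) (Γ Δ : List S) : L (C.d Γ) :=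
  sInf {p | C.VerifiesAt Γ p Δ}

/-- `f` is a maximal path: it follows the arrows of the circuit as long as possible, and a path
that arrives at a node without outgoing arrow is continued by repeating this node. -/
def IsMaximalPath (C : Circuit S O) (f : ℕ → S ⊕ O) : Prop :=
  ∀ n, C.Arr (f n) (f (n + 1)) ∨ ((∀ x, ¬ C.Arr (f n) x) ∧ f (n + 1) = f n)

/-- The s-node `s` is in the strong past of `Γ`: every (maximal) path going out from `s`
crosses `Γ`. -/
def InStrongPast (C : Circuit S O) (Γ : List S) (s : S) : Prop :=
  ∀ f : ℕ → S ⊕ O, C.IsMaximalPath f → f 0 = Sum.inl s → ∃ n, ∃ t ∈ Γ, f n = Sum.inl t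

end Circuit

end QCircuit

/-! Operations on the `Δ` side do not disturb `p ⊗ ⊤`. Membership in `p ⊗ ⊤` means that every column
lies in `p` (`mem_tensor_top`), and an operator on the other factor only forms linear combinations
of columns (`tensorId_mem_middle`). Measurements are covered because a Sasaki product lies in the
image under an orthogonal projection (`sasaki_middle_le`). So an o-node can be applied beside `Γ`
(`VerifiesAt.gate`).

It remains to carry `Δ` to `Δ'` by finitely many o-nodes. Strong past makes the search forward from
`Δ` well-founded (`InStrongPast.reaches`); branching is finite, so a finite set of o-nodes suffices
(`Reaches.exists_conducts`). These are processed earliest first (`VerifiesAt.of_conducts`): Tens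
supplies missing inputs, and at the end the missing part of `Δ'`.

The minima exist by finite dimension and Meet; their comparison is an inclusion of sets of verified
subspaces. -/

namespace QCircuit

/-! ### Subspaces of tensor products, column by column. -/

/-- The linear map `ℂⁿ → ℂᵐ` which precomposes vectors with a map of basis indices. -/
def pull {m n : ℕ} (f : Fin m → Fin n) : H n →ₗ[ℂ] H m where
  toFun w := WithLp.toLp 2 fun i => w (f i)
  map_add' _ _ := rfl
  map_smul' _ _ := rfl

@[simp]
theorem pull_apply {m n : ℕ} (f : Fin m → Fin n) (w : H n) (i : Fin m) : pull f w i = w (f i) :=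
  rfl

theorem pull_mem_of_mem_castL {m n : ℕ} (h : m = n) {p : L m} {w : H n} (hw : w ∈ castL h p) :
    pull (Fin.cast h) w ∈ p := by
  subst h
  obtain ⟨x, hx, rfl⟩ := hw
  exact hx

theorem sum_smul_single {n : ℕ} (x : H n) :
    ∑ j, x j • EuclideanSpace.single j (1 : ℂ) = x := by
  ext i
  simp [Pi.single_apply]

namespace Circuit

variable {S : Type u} {O : Type v} (C : Circuit S O)

theorem d_append (Γ Δ : List S) : C.d (Γ ++ Δ) = C.d Γ * C.d Δ :=
  (listDim_append C.dim Γ Δ).symm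

theorem idx_val (Γ Δ : List S) (i : Fin (C.d Γ)) (j : Fin (C.d Δ)) :
    (C.idx Γ Δ (i, j) : ℕ) = j + C.d Δ * i :=
  rfl

theorem cast_idx_assoc (Γ Δ Ξ : List S) (h : C.d (Γ ++ (Δ ++ Ξ)) = C.d (Γ ++ Δ ++ Ξ))
    (i : Fin (C.d Γ)) (j : Fin (C.d Δ)) (k : Fin (C.d Ξ)) :
    Fin.cast h (C.idx Γ (Δ ++ Ξ) (i, C.idx Δ Ξ (j, k))) =
      C.idx (Γ ++ Δ) Ξ (C.idx Γ Δ (i, j), k) := by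
  ext
  simp only [Fin.val_cast, idx_val, d_append]
  ring

theorem pull_tmul (Γ Δ : List S) (x : H (C.d Γ)) (y : H (C.d Δ)) (j : Fin (C.d Δ)) :
    pull (fun i => C.idx Γ Δ (i, j)) (C.tmul Γ Δ x y) = y j • x := by
  ext i
  simp [tmul, mul_comm]

theorem sum_tmul_single (Γ Δ : List S) (w : H (C.d (Γ ++ Δ))) :
    ∑ j, C.tmul Γ Δ (pull (fun i => C.idx Γ Δ (i, j)) w) (EuclideanSpace.single j 1) = w := by
  ext k
  obtain ⟨⟨i, j⟩, rfl⟩ := (C.idx Γ Δ).surjective k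
  simp [tmul]

/-- A vector lies in `p ⊗ ⊤` if and only if all its columns lie in `p`. -/
theorem mem_tensor_top {Γ Δ : List S} {p : L (C.d Γ)} {w : H (C.d (Γ ++ Δ))} :
    w ∈ C.tensor Γ Δ p ⊤ ↔ ∀ j, pull (fun i => C.idx Γ Δ (i, j)) w ∈ p := by
  constructor
  · intro hw j
    have : C.tensor Γ Δ p ⊤ ≤ p.comap (pull fun i => C.idx Γ Δ (i, j)) := by
      refine Submodule.span_le.2 ?_
      rintro _ ⟨x, hx, y, -, rfl⟩
      simp only [Submodule.comap_coe, Set.mem_preimage, pull_tmul]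
      exact p.smul_mem _ hx
    exact this hw
  · intro h
    rw [← C.sum_tmul_single Γ Δ w]
    exact Submodule.sum_mem _ fun j _ => Submodule.subset_span ⟨_, h j, _, trivial, rfl⟩

theorem pull_tensorId {Γ Γ' : List S} (Δ : List S) (A : H (C.d Γ) →ₗ[ℂ] H (C.d Γ'))
    (w : H (C.d (Γ ++ Δ))) (j : Fin (C.d Δ)) :
    pull (fun i => C.idx Γ' Δ (i, j)) (C.tensorId Δ A w) =
      A (pull (fun i => C.idx Γ Δ (i, j)) w) := by
  ext i
  simp [tensorId]
  rfl

theorem ext_columns {Γ Δ : List S} {w w' : H (C.d (Γ ++ Δ))}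
    (h : ∀ j, pull (fun i => C.idx Γ Δ (i, j)) w = pull (fun i => C.idx Γ Δ (i, j)) w') :
    w = w' := by
  rw [← C.sum_tmul_single Γ Δ w, ← C.sum_tmul_single Γ Δ w']
  simp only [h]

/-- The subspace `⊤ ⊗ p ⊗ ⊤` of `ℂ^d(Λ :: Γ :: Ξ)`. -/
def middle (Λ Γ Ξ : List S) (p : L (C.d Γ)) : L (C.d (Λ ++ (Γ ++ Ξ))) :=
  ⨅ j, ⨅ k, p.comap (pull fun i => C.idx Λ (Γ ++ Ξ) (j, C.idx Γ Ξ (i, k)))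

theorem mem_middle {Λ Γ Ξ : List S} {p : L (C.d Γ)} {w : H (C.d (Λ ++ (Γ ++ Ξ)))} :
    w ∈ C.middle Λ Γ Ξ p ↔
      ∀ j k, pull (fun i => C.idx Λ (Γ ++ Ξ) (j, C.idx Γ Ξ (i, k))) w ∈ p := by
  simp [middle]

theorem swap_tensor_le_middle (Γ Λ Ξ : List S) (p : L (C.d Γ)) :
    C.swap Γ Λ Ξ (C.tensor Γ (Λ ++ Ξ) p ⊤) ≤ C.middle Λ Γ Ξ p := by
  rintro _ ⟨w, hw, rfl⟩
  refine C.mem_middle.2 fun j k => ?_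
  convert C.mem_tensor_top.1 hw (C.idx Λ Ξ (j, k)) using 1
  ext i
  refine congrArg (fun x => w x) (?_ : (C.swapIdx Γ Λ Ξ).symm _ = _)
  simp [swapIdx]

theorem swap_middle_le_tensor (Γ Λ Ξ : List S) (p : L (C.d Γ)) :
    C.swap Λ Γ Ξ (C.middle Λ Γ Ξ p) ≤ C.tensor Γ (Λ ++ Ξ) p ⊤ := by
  rintro _ ⟨w, hw, rfl⟩
  refine C.mem_tensor_top.2 fun l => ?_
  obtain ⟨⟨j, k⟩, rfl⟩ := (C.idx Λ Ξ).surjective l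
  convert C.mem_middle.1 hw j k using 1
  ext i
  refine congrArg (fun x => w x) (?_ : (C.swapIdx Λ Γ Ξ).symm _ = _)
  simp [swapIdx]

/-- `A` touches only the `Λ` index, so each `Γ`-column of the image is a combination of `Γ`-columns
of `w`, with matrix entries of `A` as coefficients. -/
theorem tensorId_mem_middle {Λ Λ' Γ Ξ : List S} {p : L (C.d Γ)}
    (A : H (C.d Λ) →ₗ[ℂ] H (C.d Λ')) {w : H (C.d (Λ ++ (Γ ++ Ξ)))}
    (hw : w ∈ C.middle Λ Γ Ξ p) : C.tensorId (Γ ++ Ξ) A w ∈ C.middle Λ' Γ Ξ p := by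
  refine C.mem_middle.2 fun j' k => ?_
  have key : pull (fun i => C.idx Λ' (Γ ++ Ξ) (j', C.idx Γ Ξ (i, k))) (C.tensorId (Γ ++ Ξ) A w) =
      ∑ j, (A (EuclideanSpace.single j 1) j') •
        pull (fun i => C.idx Λ (Γ ++ Ξ) (j, C.idx Γ Ξ (i, k))) w := by
    ext i
    have h := congrArg (fun x => x j') (C.pull_tensorId (Γ ++ Ξ) A w (C.idx Γ Ξ (i, k)))
    rw [← sum_smul_single (pull (fun i' => C.idx Λ (Γ ++ Ξ) (i', C.idx Γ Ξ (i, k))) w)] at h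
    simp only [pull_apply, map_sum, map_smul] at h
    simp only [pull_apply, h]
    simp [mul_comm]
  rw [key]
  exact p.sum_mem fun j _ => p.smul_mem _ (C.mem_middle.1 hw j k)

theorem inner_tmul_single {Γ Δ : List S} (x : H (C.d Γ)) (j : Fin (C.d Δ))
    (w : H (C.d (Γ ++ Δ))) :
    inner ℂ (C.tmul Γ Δ x (EuclideanSpace.single j 1)) w =
      inner ℂ x (pull (fun i => C.idx Γ Δ (i, j)) w) := by
  simp only [PiLp.inner_apply, pull_apply]
  rw [← (C.idx Γ Δ).sum_comp, Fintype.sum_prod_type]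
  refine Finset.sum_congr rfl fun i _ => ?_
  rw [Finset.sum_eq_single j]
  · simp [tmul]
  · intro b _ hb
    simp [tmul, hb]
  · simp

theorem pull_mem_orthogonal {Γ Δ : List S} {q : L (C.d Γ)} {w : H (C.d (Γ ++ Δ))}
    (hw : w ∈ (C.tensor Γ Δ q ⊤)ᗮ) (j : Fin (C.d Δ)) :
    pull (fun i => C.idx Γ Δ (i, j)) w ∈ qᗮ := by
  refine (Submodule.mem_orthogonal _ _).2 fun x hx => ?_
  rw [← C.inner_tmul_single]
  exact (Submodule.mem_orthogonal _ _).1 hw _ (Submodule.subset_span ⟨x, hx, _, trivial, rfl⟩)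

/-- With `P` the projection onto `q`, `P ⊗ Id` fixes `w = a + b` and kills `b`, so `w` is the image
of `a`, and `P ⊗ Id` preserves the middle subspace. -/
theorem sasaki_middle_le (Λ Γ Ξ : List S) (p : L (C.d Γ)) (q : L (C.d Λ)) :
    sasaki (C.middle Λ Γ Ξ p) (C.tensor Λ (Γ ++ Ξ) q ⊤) ≤ C.middle Λ Γ Ξ p := by
  rintro w ⟨hwq, hw⟩
  obtain ⟨a, ha, b, hb, rfl⟩ := Submodule.mem_sup.1 hw
  let P : H (C.d Λ) →ₗ[ℂ] H (C.d Λ) := q.starProjection.toLinearMap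
  have h1 : C.tensorId (Γ ++ Ξ) P (a + b) = a + b := C.ext_columns fun j => by
    rw [pull_tensorId]
    exact Submodule.starProjection_eq_self_iff.2 (C.mem_tensor_top.1 hwq j)
  have h2 : C.tensorId (Γ ++ Ξ) P b = 0 := C.ext_columns fun j => by
    rw [pull_tensorId, map_zero]
    exact (Submodule.starProjection_apply_eq_zero_iff q).2 (C.pull_mem_orthogonal hb j)
  rw [← h1, map_add, h2, add_zero]
  exact C.tensorId_mem_middle P ha

theorem castL_middle_le {Λ Λ' : List S} (Γ Ξ : List S) (p : L (C.d Γ))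
    (h : listDim C.dim Λ = listDim C.dim Λ') :
    castL (C.d_append_congr h (Γ ++ Ξ)) (C.middle Λ Γ Ξ p) ≤ C.middle Λ' Γ Ξ p := by
  intro w hw
  refine C.mem_middle.2 fun j k => ?_
  have := C.mem_middle.1 (pull_mem_of_mem_castL _ hw) (Fin.cast h.symm j) k
  convert this using 1
  ext i
  exact congrArg (fun x => w x) (Fin.ext rfl)

theorem castL_mono {m n : ℕ} (h : m = n) {p q : L m} (hpq : p ≤ q) : castL h p ≤ castL h q :=
  Submodule.map_mono hpq

/-! ### Derived rules for verification at a slice. -/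

variable {C}

theorem Verifies.cast {Γ Γ' : List S} (h : Γ = Γ') {p : L (C.d Γ)} (hp : C.Verifies Γ p) :
    C.Verifies Γ' (castL (congrArg C.d h) p) := by
  subst h
  refine hp.ord fun w hw => ?_
  exact ⟨w, hw, rfl⟩

/-- Swap only exchanges the two leading blocks: `B` is first moved past the single block `Γ ++ A`,
then `Γ` is moved back to the front. -/
theorem VerifiesAt.swap {Γ A B Ξ : List S} {p : L (C.d Γ)}
    (hp : C.VerifiesAt Γ p (A ++ (B ++ Ξ))) :
    C.VerifiesAt Γ p (B ++ (A ++ Ξ)) := by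
  have h1 : C.Verifies ((Γ ++ A) ++ (B ++ Ξ)) (C.tensor (Γ ++ A) (B ++ Ξ) (C.tensor Γ A p ⊤) ⊤) := by
    refine (Verifies.cast (List.append_assoc Γ A (B ++ Ξ)).symm hp).ord fun w hw => ?_
    refine C.mem_tensor_top.2 fun l => C.mem_tensor_top.2 fun j => ?_
    convert C.mem_tensor_top.1 (pull_mem_of_mem_castL _ hw) (C.idx A (B ++ Ξ) (j, l)) using 1
    ext i
    simp only [pull_apply, cast_idx_assoc]
  have h2 : C.Verifies (B ++ ((Γ ++ A) ++ Ξ)) (C.middle B (Γ ++ A) Ξ (C.tensor Γ A p ⊤)) :=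
    h1.swap.ord (C.swap_tensor_le_middle _ _ _ _)
  have h3 : C.Verifies (B ++ (Γ ++ (A ++ Ξ))) (C.middle B Γ (A ++ Ξ) p) := by
    refine (Verifies.cast (by simp) h2).ord fun w hw => ?_
    refine C.mem_middle.2 fun k l => ?_
    obtain ⟨⟨j, l⟩, rfl⟩ := (C.idx A Ξ).surjective l
    convert C.mem_tensor_top.1 (C.mem_middle.1 (pull_mem_of_mem_castL _ hw) k l) j using 1
    ext i
    refine congrArg (fun x => w x) (Fin.ext ?_)
    simp only [Fin.val_cast, idx_val, d_append]
    ring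
  exact h3.swap.ord (C.swap_middle_le_tensor _ _ _ _)

theorem VerifiesAt.perm {Γ Δ Δ' : List S} {p : L (C.d Γ)} (h : Δ.Perm Δ')
    (hp : C.VerifiesAt Γ p Δ) : C.VerifiesAt Γ p Δ' := by
  -- The free tail `Ξ` lets the head `x` be parked there while the rest is permuted.
  suffices H : ∀ Ξ, C.VerifiesAt Γ p (Δ ++ Ξ) → C.VerifiesAt Γ p (Δ' ++ Ξ) by
    simpa using H [] (by simpa using hp)
  clear hp
  induction h with
  | nil => exact fun _ h => h
  | cons x _ ih =>
    intro Ξ hp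
    exact VerifiesAt.swap (B := [x]) (ih (x :: Ξ) (VerifiesAt.swap (A := [x]) hp))
  | swap x y l => exact fun Ξ hp => VerifiesAt.swap (A := [y]) (B := [x]) hp
  | trans _ _ ih ih' => exact fun Ξ hp => ih' Ξ (ih Ξ hp)

theorem VerifiesAt.append {Γ Δ Ξ : List S} {p : L (C.d Γ)} (hp : C.VerifiesAt Γ p Δ)
    (hs : C.IsSlice (Γ ++ Δ ++ Ξ)) : C.VerifiesAt Γ p (Δ ++ Ξ) := by
  refine (Verifies.cast (List.append_assoc Γ Δ Ξ) (Verifies.tens hp hs)).ord fun w hw => ?_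
  refine C.mem_tensor_top.2 fun l => ?_
  obtain ⟨⟨j, k⟩, rfl⟩ := (C.idx Δ Ξ).surjective l
  convert C.mem_tensor_top.1 (C.mem_tensor_top.1 (pull_mem_of_mem_castL _ hw) k) j using 1
  ext i
  simp only [pull_apply]
  rw [← C.cast_idx_assoc Γ Δ Ξ (by simp)]
  rfl

theorem VerifiesAt.gate {Γ Ξ : List S} {p : L (C.d Γ)} {o : O}
    (hp : C.VerifiesAt Γ p (C.inp o ++ Ξ)) (hs : C.IsSlice (C.out o ++ (Γ ++ Ξ))) :
    C.VerifiesAt Γ p (C.out o ++ Ξ) := by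
  have h1 : C.Verifies (C.inp o ++ (Γ ++ Ξ)) (C.middle (C.inp o) Γ Ξ p) :=
    (Verifies.swap hp).ord (C.swap_tensor_le_middle _ _ _ _)
  suffices h2 : C.Verifies (C.out o ++ (Γ ++ Ξ)) (C.middle (C.out o) Γ Ξ p) from
    h2.swap.ord (C.swap_middle_le_tensor _ _ _ _)
  cases ho : C.op o with
  | unitary U =>
    refine (h1.uni ho hs).ord ?_
    rintro _ ⟨w, hw, rfl⟩
    exact C.tensorId_mem_middle _ hw
  | mes h q =>
    exact (h1.sas ho hs).ord
      ((castL_mono (C.d_append_congr h _) (C.sasaki_middle_le _ _ _ _ _)).trans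
        (C.castL_middle_le _ _ _ h))

/-- Finite dimension gives a minimal verified subspace; closure under meets makes it least. -/
theorem isLeast_knowledge {Γ Δ : List S} (hs : C.IsSlice (Γ ++ Δ)) :
    IsLeast {p | C.VerifiesAt Γ p Δ} (C.knowledge Γ Δ) := by
  have hne : {p | C.VerifiesAt Γ p Δ}.Nonempty :=
    ⟨⊤, (Verifies.top hs).ord fun w _ => C.mem_tensor_top.2 fun _ => trivial⟩
  obtain ⟨m, hm, hmin⟩ := WellFounded.has_min (wellFounded_lt (α := L (C.d Γ))) _ hne
  have hle : ∀ p ∈ {p | C.VerifiesAt Γ p Δ}, m ≤ p := by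
    intro p hp
    have hmp : C.VerifiesAt Γ (m ⊓ p) Δ := (Verifies.meet hm hp).ord fun w hw =>
      C.mem_tensor_top.2 fun j => ⟨C.mem_tensor_top.1 hw.1 j, C.mem_tensor_top.1 hw.2 j⟩
    by_contra h
    exact hmin _ hmp (inf_lt_left.2 h)
  have hleast : IsLeast {p | C.VerifiesAt Γ p Δ} m := ⟨hm, hle⟩
  rw [knowledge, hleast.isGLB.sInf_eq]
  exact hleast

/-! ### The order of the nodes, and slices. -/

theorem arr_inl_inr {s : S} {o : O} : C.Arr (Sum.inl s) (Sum.inr o) ↔ s ∈ C.inp o :=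
  ⟨fun h => by cases h; assumption, Arrow.enter⟩

theorem arr_inr_inl {o : O} {s : S} : C.Arr (Sum.inr o) (Sum.inl s) ↔ s ∈ C.out o :=
  ⟨fun h => by cases h; assumption, Arrow.leave⟩

theorem before_of_mem_inp {s : S} {o : O} (h : s ∈ C.inp o) : C.Before (Sum.inl s) (Sum.inr o) :=
  .single (arr_inl_inr.2 h)

theorem before_of_mem_out {s : S} {o : O} (h : s ∈ C.out o) : C.Before (Sum.inr o) (Sum.inl s) :=
  .single (arr_inr_inl.2 h)

theorem Before.trans {a b c : S ⊕ O} (h : C.Before a b) (h' : C.Before b c) : C.Before a c :=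
  Relation.TransGen.trans h h'

theorem not_before_self (a : S ⊕ O) : ¬ C.Before a a :=
  C.acyclic a

/-- Whatever lies after an s-node lies after, or is, the o-node which it enters. -/
theorem Before.of_mem_inp {s : S} {o : O} {x : S ⊕ O} (h : C.Before (Sum.inl s) x)
    (hs : s ∈ C.inp o) : x = Sum.inr o ∨ C.Before (Sum.inr o) x := by
  obtain ⟨y, hy, hyx⟩ := Relation.TransGen.head'_iff.1 h
  cases hy with
  | enter h' =>
    cases C.inp_unique _ _ _ hs h'
    exact (Relation.reflTransGen_iff_eq_or_transGen.1 hyx)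

/-- Whatever lies before an s-node lies before, or is, the o-node which it leaves. -/
theorem Before.of_mem_out {s : S} {o : O} {x : S ⊕ O} (h : C.Before x (Sum.inl s))
    (hs : s ∈ C.out o) : x = Sum.inr o ∨ C.Before x (Sum.inr o) := by
  obtain ⟨y, hxy, hy⟩ := Relation.TransGen.tail'_iff.1 h
  cases hy with
  | leave h' =>
    cases C.out_unique _ _ _ hs h'
    exact (Relation.reflTransGen_iff_eq_or_transGen.1 hxy).imp Eq.symm id

theorem Before.exists_inp {s : S} {o : O} (h : C.Before (Sum.inl s) (Sum.inr o)) :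
    ∃ t ∈ C.inp o, t = s ∨ C.Before (Sum.inl s) (Sum.inl t) := by
  obtain ⟨y, hxy, hy⟩ := Relation.TransGen.tail'_iff.1 h
  cases hy with
  | @enter t _ h' =>
    refine ⟨t, h', ?_⟩
    exact (Relation.reflTransGen_iff_eq_or_transGen.1 hxy).imp (fun h => Sum.inl_injective h) id

theorem IsSlice.of_perm {Γ Γ' : List S} (h : C.IsSlice Γ) (hp : Γ.Perm Γ') : C.IsSlice Γ' :=
  ⟨hp.nodup_iff.1 h.1, fun s hs t ht => h.2 s (hp.mem_iff.2 hs) t (hp.mem_iff.2 ht)⟩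

/-- An input `a` precedes every output, so nothing in `Ξ` equals or follows an output; without
inputs this could fail. A node of `Ξ` before an output would be an input or precede one. -/
theorem IsSlice.gate {o : O} {Ξ : List S} (h : C.IsSlice (C.inp o ++ Ξ)) (hne : C.inp o ≠ []) :
    C.IsSlice (C.out o ++ Ξ) := by
  obtain ⟨a, ha⟩ := List.exists_mem_of_ne_nil _ hne
  have hafter : ∀ u ∈ C.out o, ∀ x ∈ Ξ, u ≠ x ∧ ¬ C.Before (Sum.inl u) (Sum.inl x) := by
    intro u hu x hx
    have hau := (before_of_mem_inp ha).trans (before_of_mem_out hu)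
    have hax := h.2 a (List.mem_append_left _ ha) x (List.mem_append_right _ hx)
    exact ⟨fun e => hax (e ▸ hau), fun hux => hax (hau.trans hux)⟩
  refine ⟨List.nodup_append'.2 ⟨C.out_nodup o, (List.nodup_append'.1 h.1).2.1, ?_⟩, ?_⟩
  · exact fun u hu hx => (hafter u hu u hx).1 rfl
  · intro s hs t ht hst
    rcases List.mem_append.1 ht with ht | ht
    · rcases List.mem_append.1 hs with hs | hs
      · rcases hst.of_mem_out ht with e | hso
        · cases e
        · exact not_before_self _ ((before_of_mem_out hs).trans hso)
      · rcases hst.of_mem_out ht with e | hso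
        · cases e
        obtain ⟨b, hb, rfl | hsb⟩ := hso.exists_inp
        · exact (List.nodup_append'.1 h.1).2.2 hb hs
        · exact h.2 s (List.mem_append_right _ hs) b (List.mem_append_left _ hb) hsb
    · rcases List.mem_append.1 hs with hs | hs
      · exact (hafter s hs t ht).2 hst
      · exact h.2 s (List.mem_append_right _ hs) t (List.mem_append_right _ ht) hst

/-! ### From strong past to a finite set of o-nodes. -/

/-- `C.Reaches Γ x`: following the arrows from the node `x` leads to `Γ` in boundedly many steps. -/
inductive Reaches (C : Circuit S O) (Γ : List S) : S ⊕ O → Prop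
  | of_mem {s : S} : s ∈ Γ → Reaches C Γ (Sum.inl s)
  | of_arr {x : S ⊕ O} : (∃ y, C.Arr x y) → (∀ y, C.Arr x y → Reaches C Γ y) → Reaches C Γ x

/-- Otherwise, choosing a successor that fails to reach `Γ` whenever there is one traces a maximal
path that misses `Γ`. -/
theorem InStrongPast.reaches {Γ : List S} {s : S} (h : C.InStrongPast Γ s) :
    C.Reaches Γ (Sum.inl s) := by
  classical
  by_contra hs
  let next : S ⊕ O → S ⊕ O := fun x =>
    if h : ∃ y, C.Arr x y ∧ ¬ C.Reaches Γ y then h.choose else x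
  have hnext : ∀ x, ¬ C.Reaches Γ x →
      ¬ C.Reaches Γ (next x) ∧ (C.Arr x (next x) ∨ ((∀ y, ¬ C.Arr x y) ∧ next x = x)) := by
    intro x hx
    by_cases h : ∃ y, C.Arr x y ∧ ¬ C.Reaches Γ y
    · simp only [next, dif_pos h]
      exact ⟨h.choose_spec.2, Or.inl h.choose_spec.1⟩
    -- Here `x` has no successor at all: if it had some, all would reach `Γ`, and so would `x`.
    · have hn : next x = x := dif_neg h
      refine ⟨hn.symm ▸ hx, Or.inr ⟨fun y hy => hx ?_, hn⟩⟩
      push Not at h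
      exact .of_arr ⟨y, hy⟩ h
  have hbad : ∀ n, ¬ C.Reaches Γ (next^[n] (Sum.inl s)) := by
    intro n
    induction n with
    | zero => exact hs
    | succ n ih =>
      rw [Function.iterate_succ_apply']
      exact (hnext _ ih).1
  obtain ⟨n, t, ht, hn⟩ := h (fun n => next^[n] (Sum.inl s))
    (fun n => by simpa only [Function.iterate_succ_apply'] using (hnext _ (hbad n)).2) rfl
  exact hbad n (hn ▸ .of_mem ht)

/-- The o-nodes in `F` lie before `Γ`, and a path going out from one of them stays in `F` until it
arrives at `Γ`. -/
structure Conducts (C : Circuit S O) (Γ : List S) (F : Finset O) : Prop where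
  before : ∀ o ∈ F, ∃ t ∈ Γ, C.Before (Sum.inr o) (Sum.inl t)
  out : ∀ o ∈ F, ∀ s ∈ C.out o, s ∈ Γ ∨ ∃ o' ∈ F, s ∈ C.inp o'

/-- A node belongs to `Γ`, or enters an o-node in `F`, or is an o-node in `F`. -/
def Covered (C : Circuit S O) (Γ : List S) (F : Finset O) : S ⊕ O → Prop
  | Sum.inl s => s ∈ Γ ∨ ∃ o ∈ F, s ∈ C.inp o
  | Sum.inr o => o ∈ F

theorem Covered.mono {Γ : List S} {F F' : Finset O} (h : F ⊆ F') :
    ∀ {x : S ⊕ O}, C.Covered Γ F x → C.Covered Γ F' x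
  | Sum.inl _, hx => hx.imp id fun ⟨o, ho, hs⟩ => ⟨o, h ho, hs⟩
  | Sum.inr _, hx => h hx

theorem exists_conducts_list {Γ : List S} (Δ : List S)
    (h : ∀ s ∈ Δ, ∃ F, C.Conducts Γ F ∧ C.Covered Γ F (Sum.inl s)) :
    ∃ F, C.Conducts Γ F ∧ ∀ s ∈ Δ, C.Covered Γ F (Sum.inl s) := by
  classical
  induction Δ with
  | nil => exact ⟨∅, ⟨by simp, by simp⟩, by simp⟩
  | cons a Δ ih =>
    obtain ⟨F, hF, hFs⟩ := ih fun s hs => h s (List.mem_cons_of_mem _ hs)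
    obtain ⟨E, hE, hEa⟩ := h a List.mem_cons_self
    refine ⟨E ∪ F, ⟨fun o ho => ?_, fun o ho s hs => ?_⟩, fun s hs => ?_⟩
    · exact (Finset.mem_union.1 ho).elim (hE.before o) (hF.before o)
    · rcases Finset.mem_union.1 ho with ho | ho
      · exact Covered.mono (x := Sum.inl s) Finset.subset_union_left (hE.out o ho s hs)
      · exact Covered.mono (x := Sum.inl s) Finset.subset_union_right (hF.out o ho s hs)
    · rcases List.mem_cons.1 hs with rfl | hs
      · exact hEa.mono Finset.subset_union_left
      · exact (hFs s hs).mono Finset.subset_union_right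

theorem Reaches.exists_conducts {Γ : List S} {x : S ⊕ O} (h : C.Reaches Γ x) :
    ∃ F, C.Conducts Γ F ∧ C.Covered Γ F x := by
  classical
  induction h with
  | of_mem hs => exact ⟨∅, ⟨by simp, by simp⟩, Or.inl hs⟩
  | @of_arr x hx _ ih =>
    cases x with
    | inl s =>
      obtain ⟨_ | o, hy⟩ := hx
      · cases hy
      have hs := arr_inl_inr.1 hy
      obtain ⟨F, hF, ho⟩ := ih _ (Arrow.enter hs)
      exact ⟨F, hF, Or.inr ⟨o, ho, hs⟩⟩
    | inr o =>
      obtain ⟨F, hF, hout⟩ := exists_conducts_list (C.out o) fun s hs => ih _ (Arrow.leave hs)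
      refine ⟨insert o F, ⟨fun o' ho' => ?_, fun o' ho' s hs => ?_⟩, Finset.mem_insert_self _ _⟩
      · rcases Finset.mem_insert.1 ho' with rfl | ho'
        -- Reaching `Γ` includes having a successor, so `o` has an output, which leads on to `Γ`.
        · obtain ⟨s | _, hy⟩ := hx
          swap
          · cases hy
          have hs := arr_inr_inl.1 hy
          rcases hout s hs with ht | ⟨o, ho, hso⟩
          · exact ⟨s, ht, before_of_mem_out hs⟩
          · obtain ⟨t, ht, hot⟩ := hF.before o ho
            exact ⟨t, ht, (before_of_mem_out hs).trans ((before_of_mem_inp hso).trans hot)⟩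
        · exact hF.before o' ho'
      · refine Covered.mono (x := Sum.inl s) (Finset.subset_insert o F) ?_
        rcases Finset.mem_insert.1 ho' with rfl | ho'
        · exact hout s hs
        · exact hF.out o' ho' s hs

/-! ### Pushing the slice forward. -/

theorem exists_first (F : Finset O) (hF : F.Nonempty) :
    ∃ o ∈ F, ∀ o' ∈ F, ¬ C.Before (Sum.inr o') (Sum.inr o) := by
  let r : O → O → Prop := fun a b => C.Before (Sum.inr a) (Sum.inr b)
  have : IsStrictOrder O r :=
    { irrefl := fun a => not_before_self _, trans := fun _ _ _ h h' => h.trans h' }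
  obtain ⟨o, ho, hmin⟩ := (F.finite_toSet.wellFoundedOn (r := r)).has_min
    (Set.univ) (by obtain ⟨o, ho⟩ := hF; exact ⟨⟨o, ho⟩, trivial⟩)
  exact ⟨o, o.2, fun o' ho' => hmin ⟨o', ho'⟩ trivial⟩

theorem VerifiesAt.of_subset {Γ Δ Δ' : List S} {p : L (C.d Γ)} (hp : C.VerifiesAt Γ p Δ)
    (hΔ : C.IsSlice (Γ ++ Δ)) (hΔ' : C.IsSlice (Γ ++ Δ')) (h : Δ ⊆ Δ') :
    C.VerifiesAt Γ p Δ' := by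
  classical
  have hn := (List.nodup_append'.1 hΔ.1).2.1
  have hn' := (List.nodup_append'.1 hΔ'.1).2.1
  have hperm : (Δ ++ Δ'.filter (· ∉ Δ)).Perm Δ' := by
    refine (List.perm_ext_iff_of_nodup ?_ hn').2 fun s => ?_
    · refine List.nodup_append'.2 ⟨hn, hn'.filter _, fun s hs hs' => ?_⟩
      simp [hs] at hs'
    · have := @h s
      simp only [List.mem_append, List.mem_filter, decide_eq_true_eq]
      tauto
  refine (hp.append ?_).perm hperm
  rw [List.append_assoc]
  exact hΔ'.of_perm (hperm.symm.append_left Γ)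

theorem VerifiesAt.of_conducts {Γ Δ' : List S} {p : L (C.d Γ)} (hΔ' : C.IsSlice (Γ ++ Δ'))
    (F : Finset O) : ∀ Δ : List S, C.IsSlice (Γ ++ Δ) → C.Conducts Δ' F →
      (∀ s ∈ Δ, C.Covered Δ' F (Sum.inl s)) → C.VerifiesAt Γ p Δ → C.VerifiesAt Γ p Δ' := by
  classical
  induction hk : F.card generalizing F with
  | zero =>
    intro Δ hΔ _ hcov hp
    cases Finset.card_eq_zero.1 hk
    exact hp.of_subset hΔ hΔ' fun s hs => (hcov s hs).resolve_right (by simp)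
  | succ k ih =>
    intro Δ hΔ hF hcov hp
    obtain ⟨o, ho, hmin⟩ := exists_first (C := C) F (Finset.card_pos.1 (by omega))
    have hcard : (F.erase o).card = k := by rw [Finset.card_erase_of_mem ho, hk]; rfl
    have hF' : C.Conducts Δ' (F.erase o) := by
      refine ⟨fun o' ho' => hF.before o' (Finset.mem_of_mem_erase ho'), fun o' ho' s hs => ?_⟩
      have ho'F := Finset.mem_of_mem_erase ho'
      refine (hF.out o' ho'F s hs).imp id ?_
      rintro ⟨o'', ho'', hs''⟩
      refine ⟨o'', Finset.mem_erase.2 ⟨?_, ho''⟩, hs''⟩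
      -- An output of `o'` entering `o` would contradict the minimality of `o`.
      rintro rfl
      exact hmin o' ho'F ((before_of_mem_out hs).trans (before_of_mem_inp hs''))
    have hkeep : ∀ s ∈ Δ, s ∉ C.inp o → C.Covered Δ' (F.erase o) (Sum.inl s) := by
      intro s hs hso
      refine (hcov s hs).imp id ?_
      rintro ⟨o', ho', hs'⟩
      exact ⟨o', Finset.mem_erase.2 ⟨fun e => hso (e ▸ hs'), ho'⟩, hs'⟩
    -- If no member of `Δ` enters `o`, then `o` is discarded without applying its operation.
    by_cases hdrop : ∀ s ∈ Δ, s ∉ C.inp o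
    · exact ih _ hcard Δ hΔ hF' (fun s hs => hkeep s hs (hdrop s hs)) hp
    push Not at hdrop
    obtain ⟨a, haΔ, hao⟩ := hdrop
    obtain ⟨b, hbΔ', hob⟩ := hF.before o ho
    have hΔn := List.nodup_append'.1 hΔ.1
    -- the inputs of `o` outside of `Δ` can be added to the slice
    have hafter : ∀ t ∈ C.inp o, ∀ s ∈ Γ ++ Δ, ¬ C.Before (Sum.inl t) (Sum.inl s) := by
      intro t ht s hs hts
      rcases hts.of_mem_inp ht with e | hos
      · cases e
      · exact hΔ.2 a (List.mem_append_right _ haΔ) s hs ((before_of_mem_inp hao).trans hos)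
    -- Such an `s` precedes `b ∈ Δ'`, so it is outside `Γ ++ Δ'` and enters some `o' ∈ F`; then `o'`
    -- precedes `o`, against minimality.
    have hbefore : ∀ t ∈ C.inp o, ∀ s ∈ Γ ++ Δ, ¬ C.Before (Sum.inl s) (Sum.inl t) := by
      intro t ht s hs hst
      have hsb := hst.trans ((before_of_mem_inp ht).trans hob)
      have hnot : s ∉ Γ ++ Δ' := fun h => hΔ'.2 s h b (List.mem_append_right _ hbΔ') hsb
      rw [List.mem_append, not_or] at hnot
      have hsΔ := (List.mem_append.1 hs).resolve_left hnot.1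
      obtain ⟨o', ho', hso'⟩ := (hcov s hsΔ).resolve_left hnot.2
      rcases hst.of_mem_inp hso' with e | h
      · cases e
      · exact hmin o' ho' (h.trans (before_of_mem_inp ht))
    have hΓ : ∀ t ∈ C.inp o, t ∉ Γ := fun t ht htΓ =>
      hΔ'.2 t (List.mem_append_left _ htΓ) b (List.mem_append_right _ hbΔ')
        ((before_of_mem_inp ht).trans hob)
    have hself : ∀ t ∈ C.inp o, ∀ t' ∈ C.inp o, ¬ C.Before (Sum.inl t) (Sum.inl t') := by
      intro t ht t' ht' h
      rcases h.of_mem_inp ht with e | h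
      · cases e
      · exact not_before_self _ (h.trans (before_of_mem_inp ht'))
    have hslice : C.IsSlice (Γ ++ Δ ++ (C.inp o).filter (· ∉ Δ)) := by
      refine ⟨List.nodup_append'.2 ⟨hΔ.1, (C.inp_nodup o).filter _, fun s hs hs' => ?_⟩, ?_⟩
      · simp only [List.mem_filter, decide_eq_true_eq] at hs'
        exact (List.mem_append.1 hs).elim (hΓ s hs'.1) hs'.2
      · intro s hs t ht
        have hT : ∀ {x}, x ∈ (C.inp o).filter (· ∉ Δ) → x ∈ C.inp o :=
          fun h => List.mem_of_mem_filter h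
        rcases List.mem_append.1 hs with hs | hs <;> rcases List.mem_append.1 ht with ht | ht
        · exact hΔ.2 s hs t ht
        · exact hbefore t (hT ht) s hs
        · exact hafter s (hT hs) t ht
        · exact hself s (hT hs) t (hT ht)
    have hperm : (Δ ++ (C.inp o).filter (· ∉ Δ)).Perm (C.inp o ++ Δ.filter (· ∉ C.inp o)) := by
      refine (List.perm_ext_iff_of_nodup ?_ ?_).2 fun s => ?_
      · rw [List.append_assoc] at hslice
        exact (List.nodup_append'.1 hslice.1).2.1
      · refine List.nodup_append'.2 ⟨C.inp_nodup o, hΔn.2.1.filter _, fun s hs hs' => ?_⟩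
        simp [hs] at hs'
      · simp only [List.mem_append, List.mem_filter, decide_eq_true_eq]
        tauto
    have hslice' : C.IsSlice (C.out o ++ (Γ ++ Δ.filter (· ∉ C.inp o))) := by
      refine IsSlice.gate (hslice.of_perm ?_) (List.ne_nil_of_mem hao)
      rw [List.append_assoc]
      refine (hperm.append_left Γ).trans ?_
      rw [← List.append_assoc, ← List.append_assoc]
      exact List.perm_append_comm.append_right _
    refine ih _ hcard (C.out o ++ Δ.filter (· ∉ C.inp o)) (hslice'.of_perm ?_) hF' ?_
      (((hp.append hslice).perm hperm).gate hslice')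
    · rw [← List.append_assoc, ← List.append_assoc]
      exact List.perm_append_comm.append_right _
    · intro s hs
      rcases List.mem_append.1 hs with hs | hs
      · refine (hF.out o ho s hs).imp id ?_
        rintro ⟨o', ho', hs'⟩
        refine ⟨o', Finset.mem_erase.2 ⟨?_, ho'⟩, hs'⟩
        -- An output of `o` re-entering `o` would close a cycle.
        rintro rfl
        exact not_before_self _ ((before_of_mem_out hs).trans (before_of_mem_inp hs'))
      · simp only [List.mem_filter, decide_eq_true_eq] at hs
        exact hkeep s hs.1 hs.2

theorem VerifiesAt.of_inStrongPast {Γ Δ Δ' : List S} {p : L (C.d Γ)} (hΔ : C.IsSlice (Γ ++ Δ))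
    (hΔ' : C.IsSlice (Γ ++ Δ')) (hpast : ∀ s ∈ Δ, C.InStrongPast Δ' s)
    (hp : C.VerifiesAt Γ p Δ) : C.VerifiesAt Γ p Δ' := by
  obtain ⟨F, hF, hcov⟩ := exists_conducts_list Δ fun s hs => (hpast s hs).reaches.exists_conducts
  exact .of_conducts hΔ' F Δ hΔ hF hcov hp

end Circuit

end QCircuit

theorem mainTheorem6 {S : Type u} {O : Type v} (C : QCircuit.Circuit S O) (Γ Δ Δ' : List S)
    (hΔ : C.IsSlice (Γ ++ Δ)) (hΔ' : C.IsSlice (Γ ++ Δ'))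
    (hpast : ∀ s ∈ Δ, C.InStrongPast Δ' s) :
    (∀ p : QCircuit.L (C.d Γ), C.VerifiesAt Γ p Δ → C.VerifiesAt Γ p Δ') ∧
      IsLeast {p | C.VerifiesAt Γ p Δ} (C.knowledge Γ Δ) ∧
      IsLeast {p | C.VerifiesAt Γ p Δ'} (C.knowledge Γ Δ') ∧
      C.knowledge Γ Δ' ≤ C.knowledge Γ Δ := by
  have h : ∀ p : QCircuit.L (C.d Γ), C.VerifiesAt Γ p Δ → C.VerifiesAt Γ p Δ' :=
    fun _ hp => .of_inStrongPast hΔ hΔ' hpast hp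
  exact ⟨h, QCircuit.Circuit.isLeast_knowledge hΔ, QCircuit.Circuit.isLeast_knowledge hΔ',
    sInf_le_sInf h⟩
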